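/- **Setting.** A bivalent characteristic string is $w=w_1\ldots w_n\in\{H,A\}^n$; slot $t$ is honest if $w_t=H$ and adversarial if $w_t=A$. Such strings are ordered coordinatewise with $H<A$. A *fork* for $w$ is a finite rooted tree whose vertices carry labels in $\{0,\ldots,n\}$ such that the root has label $0$; labels strictly increase along every path from the root; every honest slot labels at least one vertex; and if $i<j$ are honest slots, every vertex labelled $i$ has strictly smaller depth than every vertex labelled $j$. A *tine* is a path starting at the root; its length is its number of edges and its label is that of its last vertex, and it is adversarial if that label is an adversarial slot. *Consistent tie-breaking.* A tie-breaking rule $R$ selects from each nonempty finite set of chains one of its members, depending on that set only. A fork $F$ follows $R$ if for every honest slot $j$ the following holds: if no maximum-length tine of $F_{<j}$ (the part of $F$ with labels less than $j$) is adversarial, then all vertices labelled $j$ are children of the endpoint of the tine that $R$ selects from the set of maximum-length tines of $F_{<j}$. (If some maximum-length tine of $F_{<j}$ is adversarial, there is no further restriction on the vertices labelled $j$.) *Settlement.* Slot $s$ is *not $k$-settled* in $w\in\{H,A\}^T$ if, for some prefix $\hat w$ of $w$ with $|\hat w|\ge s+k$, some fork for $\hat w$ that follows $R$ contains two maximum-length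 tines that contain different vertices labelled $s$, or exactly one of which contains a vertex labelled $s$. For a distribution $\mathcal D$ on $\{H,A\}^T$, the *settlement insecurity* is $$\mathbf S_R^{s,k}[\mathcal D]=\Pr_{w\sim\mathcal D}[\text{slot } s \text{ is not } k\text{-settled in } w].$$ **Theorem.** There is an absolute constant $c>0$ such that the following holds for every tie-breaking rule $R$, every $\epsilon\in(0,1)$ and all $s,k,T\in\mathbb N$. Let $\mathcal B$ be the distribution on $\{H,A\}^T$ under which the letters are independent, each equal to $A$ with probability $(1-\epsilon)/2$ and to $H$ with probability $(1+\epsilon)/2$, and let $\mathcal W$ be a distribution on $\{H,A\}^T$ that is stochastically dominated by $\mathcal B$, that is, $\mathcal W(E)\le\mathcal B(E)$ for every upward closed set $E\subseteq\{H,A\}^T$. Then $$\mathbf S_R^{s,k}[\mathcal W]\;\le\;\mathbf S_R^{s,k}[\mathcal B]\;\le\;\exp\bigl(-c\,\epsilon^3\,k\bigr).$$ -/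

import Mathlib

/-! Bivalent characteristic strings -/

/-- The alphabet of bivalent characteristic strings: `H` marks a slot with one or more leaders, all
of them honest; `A` marks an adversarial slot. -/
inductive Letter where
  | H : Letter
  | A : Letter
  deriving DecidableEq

/-- `H ↦ 0`, `A ↦ 1`. -/
def Letter.toNat : Letter → ℕ
  | .H => 0
  | .A => 1

theorem Letter.toNat_injective : Function.Injective Letter.toNat := by
  intro a b h
  cases a <;> cases b <;> simp_all [Letter.toNat]

/-- The order `H < A` ("more adversarial"). -/
instance : LinearOrder Letter := LinearOrder.lift' Letter.toNat Letter.toNat_injective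

/-- Bivalent characteristic strings of length `n`, with the coordinatewise order. The letter
`w i` belongs to the slot `i + 1`: slots are numbered `1, …, n`, and slot `0` is reserved for the
genesis block. -/
abbrev CharString (n : ℕ) : Type := Fin n → Letter

/-- Slot `j` is honest in `w`. -/
def HonestSlot {n : ℕ} (w : CharString n) (j : ℕ) : Prop :=
  ∃ i : Fin n, (i : ℕ) + 1 = j ∧ w i = Letter.H

/-- Slot `j` is adversarial in `w`. -/
def AdversarialSlot {n : ℕ} (w : CharString n) (j : ℕ) : Prop :=
  ∃ i : Fin n, (i : ℕ) + 1 = j ∧ w i = Letter.A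

/-! Blockchains and forks -/

/-- An abstract block other than the genesis block: the slot that labels it, and an identity that
distinguishes blocks of the same slot built on the same chain. -/
structure Block where
  slot : ℕ
  ident : ℕ
  deriving DecidableEq

/-- A blockchain, listed from the genesis block (which is left out of the list) to its tip.
Since a block commits to its whole history, a vertex of a tree of blocks is the same thing as the
chain from the root to it. So a `Chain` is both a vertex and the tine that ends at it; the root is
`[]`, the parent of `C ++ [b]` is `C`, the depth of a vertex (the length of a tine) is the length
of the list, and "the vertex `P` lies on the tine `C`" is `P <+: C`. -/
abbrev Chain : Type := List Block

/-- The label of a vertex (tine): the slot of the last block, and `0` for the genesis block. -/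
def Chain.label (C : Chain) : ℕ := (C.getLast?.map Block.slot).getD 0

/-- `IsFork w F`: the finite rooted labelled tree `F` (its set of vertices, closed under passing to
the parent) is a fork for `w`. -/
structure IsFork {n : ℕ} (w : CharString n) (F : Finset Chain) : Prop where
  /-- The genesis block is the root; its label is `0`. -/
  root_mem : ([] : Chain) ∈ F
  /-- `F` is a tree. -/
  prefix_mem : ∀ C ∈ F, ∀ P : Chain, P <+: C → P ∈ F
  /-- Labels lie in `{0, …, n}`. -/
  label_le : ∀ C ∈ F, C.label ≤ n
  /-- Labels strictly increase along each path from the root (which has label `0`). -/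
  strict_mono : ∀ C ∈ F, List.Pairwise (· < ·) (0 :: C.map Block.slot)
  /-- Every honest slot labels at least one vertex. -/
  honest_exists : ∀ j, HonestSlot w j → ∃ C ∈ F, C.label = j
  /-- Honest depths strictly increase. -/
  honest_depth : ∀ i j, HonestSlot w i → HonestSlot w j → i < j →
    ∀ C ∈ F, ∀ D ∈ F, C.label = i → D.label = j → C.length < D.length

/-- The maximum-length tines of `F`. -/
def longest (F : Finset Chain) : Finset Chain :=
  F.filter fun C => ∀ D ∈ F, D.length ≤ C.length

/-- The part of `F` with labels smaller than `j`. -/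
def before (F : Finset Chain) (j : ℕ) : Finset Chain :=
  F.filter fun C => C.label < j

/-! Consistent longest-chain tie-breaking -/

/-- A consistent tie-breaking rule: the chain selected is a function of the set of candidate
chains alone, and it is one of the candidates. -/
structure TieBreakingRule where
  choose : Finset Chain → Chain
  choose_mem : ∀ S : Finset Chain, S.Nonempty → choose S ∈ S

/-- `F` has a tie for the longest-chain rule: some maximum-length tine is adversarial. -/
def HasLCRTie {n : ℕ} (w : CharString n) (F : Finset Chain) : Prop :=
  ∃ C ∈ longest F, AdversarialSlot w C.label

/-- The honest players use the rule `R` in `F`. If the part of the fork that precedes an honest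
slot `j` has a tie for the longest-chain rule, then the adversary, who decides which player
sees which adversarial chain, may place the blocks of slot `j` wherever the definition of a fork
allows it. If there is no such tie, then the longest chains are honest, hence known to everybody, and
every block of slot `j` extends the one that `R` selects among them. -/
def FollowsRule (R : TieBreakingRule) {n : ℕ} (w : CharString n) (F : Finset Chain) : Prop :=
  ∀ j, HonestSlot w j → ¬ HasLCRTie w (before F j) →
    ∀ (C : Chain) (b : Block), C ++ [b] ∈ F → b.slot = j → C = R.choose (longest (before F j))

/-! Settlement -/

/-- The tines `C` and `D` diverge prior to slot `s`: they contain different vertices labelled `s`, or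
exactly one of them contains a vertex labelled `s`. -/
def DivergePriorTo (s : ℕ) (C D : Chain) : Prop :=
  (∃ P Q : Chain, P <+: C ∧ Q <+: D ∧ P.label = s ∧ Q.label = s ∧ P ≠ Q) ∨
    ¬ ((∃ P : Chain, P <+: C ∧ P.label = s) ↔ ∃ Q : Chain, Q <+: D ∧ Q.label = s)

/-- Slot `s` is not `k`-settled in `w` (when the honest players use the rule `R`): some fork for a
prefix of `w` of length at least `s + k` has two maximum-length tines that diverge prior to `s`. -/
def NotSettled (R : TieBreakingRule) (s k : ℕ) {T : ℕ} (w : CharString T) : Prop :=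
  ∃ (t : ℕ) (h : t ≤ T), s + k ≤ t ∧ ∃ F : Finset Chain,
    IsFork (Fin.take t h w) F ∧ FollowsRule R (Fin.take t h w) F ∧
      ∃ C ∈ longest F, ∃ D ∈ longest F, DivergePriorTo s C D

/-- The `(s, k)`-settlement insecurity of the distribution `𝒟`: the probability that a string drawn
from `𝒟` admits a settlement violation (by an adversary who knows the whole string). -/
noncomputable def settlementInsecurity (R : TieBreakingRule) (s k : ℕ) {T : ℕ}
    (𝒟 : PMF (CharString T)) : ℝ :=
  (𝒟.toOuterMeasure {w | NotSettled R s k w}).toReal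

/-! Distributions on bivalent characteristic strings -/

/-- The letters of `w ∼ 𝒟` are independent, each equal to `A` with probability `(1 - ε) / 2` and to
`H` otherwise. -/
def IsBernoulli (ε : ℝ) {T : ℕ} (𝒟 : PMF (CharString T)) : Prop :=
  ∀ w : CharString T,
    𝒟 w = ∏ i, ENNReal.ofReal (if w i = Letter.A then (1 - ε) / 2 else 1 - (1 - ε) / 2)

/-- `𝒲` is stochastically dominated by `ℬ`: no monotone set is more likely under `𝒲`. -/
def StochDominatedBy {T : ℕ} (𝒲 ℬ : PMF (CharString T)) : Prop :=
  ∀ E : Set (CharString T), IsUpperSet E → 𝒲.toOuterMeasure E ≤ ℬ.toOuterMeasure E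

/-! The proof rests on pairs of consecutive honest slots `i + 1`, `i + 2` such that every interval
ending just before the pair or beginning just after it has at least as many honest as adversarial
slots (`GoodAt`). Every interval that contains either slot then has a strict honest majority. A tine
at least as long as all honest vertices so far cannot avoid such a slot: after its last honest
vertex before the slot it would have to match at least one level per honest slot with blocks of
distinct adversarial slots (`IsFork.exists_prefix_label_eq`).

Hence, when slot `i + 2` is played, all longest tines end at slot `i + 1`. There is no adversarial
tie, and `R` gives all vertices of slot `i + 2` the same parent. Every longest tine of the final
fork contains a vertex of slot `i + 2`, so all of them pass through that parent
(`GoodAt.exists_common_prefix`). Two longest tines therefore cannot diverge prior to any `s ≤ i +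
1`, and a settlement violation excludes good pairs from a window of `k` positions.

It remains to bound the probability of a window without good pairs for independent letters. The past
condition says that the honest-minus-adversarial walk is at its running maximum, and the future
condition that it never drops below its level just after the pair. Exponential potentials for the
gap to the maximum and for the height of a pending candidate give decay by `1 - ε ^ 3 / 64` per
letter, up to a factor 2 (`DecayRates.noGood_bound`, `prob_noGoodIn_le`); a union bound removes that
factor for short windows (`prob_noGoodIn_le_exp`). Domination is handled by monotonicity: making
slots adversarial only removes constraints on forks (`isUpperSet_notSettled`). -/

open Letter

/-! ### Balance of a string and good pairs -/

/-- Value of a letter in the walk that goes up at honest slots and down at adversarial slots. -/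
def Letter.val : Letter → ℤ
  | .H => 1
  | .A => -1

/-- Number of honest letters minus number of adversarial letters. -/
def bal (l : List Letter) : ℤ := (l.map Letter.val).sum

@[simp] theorem bal_nil : bal [] = 0 := rfl
@[simp] theorem bal_cons (a : Letter) (l : List Letter) : bal (a :: l) = a.val + bal l := by
  simp [bal]
@[simp] theorem bal_append (l m : List Letter) : bal (l ++ m) = bal l + bal m := by
  simp [bal]

/-- The honest letters at positions `i` and `i + 1` are such that every interval that ends just
before them, or begins just after them, has at least as many honest as adversarial letters. -/
def GoodAt (l : List Letter) (i : ℕ) : Prop :=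
  ∃ x y, l = x ++ H :: H :: y ∧ x.length = i ∧ (∀ z, z <:+ x → 0 ≤ bal z) ∧
    ∀ z, z <+: y → 0 ≤ bal z

/-- Passing to a factor that contains the pair shortens `x` to a suffix and `y` to a prefix, so
fewer conditions remain. -/
theorem GoodAt.of_append {u l v : List Letter} {i : ℕ} (h : GoodAt (u ++ l ++ v) (u.length + i))
    (hi : i + 2 ≤ l.length) : GoodAt l i := by
  obtain ⟨x, y, he, hx, h1, h2⟩ := h
  have hux : u <+: x := by
    refine List.prefix_of_prefix_length_le (l₃ := u ++ l ++ v) ?_ ?_ (by omega)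
    · simp [List.append_assoc]
    · rw [he]; simp
  obtain ⟨x', rfl⟩ := hux
  simp only [List.append_assoc, List.append_cancel_left_eq] at he
  have hx' : x'.length = i := by simpa using hx
  have hl : x' ++ [H, H] <+: l := by
    refine List.prefix_of_prefix_length_le (l₃ := l ++ v) ?_ (by simp) (by simp; omega)
    rw [he]; exact ⟨y, by simp⟩
  obtain ⟨y', rfl⟩ := hl
  refine ⟨x', y', by simp, hx', fun z hz => h1 z (hz.trans (by simp)), fun z hz => h2 z ?_⟩
  simp only [List.append_assoc, List.append_cancel_left_eq, List.cons_append, List.nil_append,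
    List.cons.injEq, true_and] at he
  rw [← he]
  exact hz.trans (by simp)

theorem GoodAt.take {l : List Letter} {i t : ℕ} (h : GoodAt l i) (hi : i + 2 ≤ t)
    (ht : t ≤ l.length) : GoodAt (l.take t) i := by
  refine GoodAt.of_append (u := []) (v := l.drop t) (by simpa using h) ?_
  simp; omega

/-- The walk is at most `bal x` up to the pair, equals `bal x + 1` between its two letters, and is
at least `bal x + 2` afterwards. The two alternatives are the intervals containing the first and the
second letter. -/
theorem GoodAt.bal_take_lt {l : List Letter} {i a b : ℕ} (h : GoodAt l i)
    (hab : a ≤ i ∧ i + 1 ≤ b ∨ a ≤ i + 1 ∧ i + 2 ≤ b) : bal (l.take a) < bal (l.take b) := by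
  obtain ⟨x, y, rfl, rfl, h1, h2⟩ := h
  have ha : ∀ a ≤ x.length, bal ((x ++ H :: H :: y).take a) ≤ bal x := by
    intro a ha
    rw [List.take_append_of_le_length ha]
    have h3 := h1 _ (List.drop_suffix a x)
    have h4 := bal_append (x.take a) (x.drop a)
    rw [List.take_append_drop] at h4
    omega
  have ha' : bal ((x ++ H :: H :: y).take (x.length + 1)) = bal x + 1 := by
    rw [List.take_length_add_append]
    simp [Letter.val]
  have hb : ∀ b, x.length + 2 ≤ b → bal x + 2 ≤ bal ((x ++ H :: H :: y).take b) := by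
    intro b hb
    obtain ⟨c, rfl⟩ := Nat.exists_eq_add_of_le hb
    have h3 := h2 _ (List.take_prefix c y)
    rw [add_assoc, List.take_length_add_append, show 2 + c = c + 1 + 1 by omega, List.take_succ_cons,
      List.take_succ_cons]
    simp [Letter.val]
    omega
  rcases hab with ⟨h3, h4⟩ | ⟨h3, h4⟩
  · have := ha a h3
    rcases h4.eq_or_lt with rfl | h5
    · omega
    · have := hb b h5
      omega
  · have := hb b h4
    rcases h3.eq_or_lt with rfl | h5
    · omega
    · have := ha a (by omega)
      omega

/-! Counting honest and adversarial slots -/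

section Count
open Classical

variable {n : ℕ} (w : CharString n)

/-- The number of honest slots in `(a, b]`. -/
noncomputable def honestCount (a b : ℕ) : ℕ := ((Finset.Ioc a b).filter (HonestSlot w)).card

/-- The number of adversarial slots in `(a, b]`. -/
noncomputable def advCount (a b : ℕ) : ℕ := ((Finset.Ioc a b).filter (AdversarialSlot w)).card

variable {w}

theorem HonestSlot.not_adversarial {j : ℕ} (h : HonestSlot w j) : ¬ AdversarialSlot w j := by
  rintro ⟨i, hi, hA⟩
  obtain ⟨i', hi', hH⟩ := h
  have : i = i' := by ext; omega
  subst this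
  simp [hA] at hH

theorem HonestSlot.pos {j : ℕ} (h : HonestSlot w j) : 0 < j := by
  obtain ⟨i, hi, -⟩ := h; omega

theorem HonestSlot.le {j : ℕ} (h : HonestSlot w j) : j ≤ n := by
  obtain ⟨i, hi, -⟩ := h; omega

theorem adversarialSlot_of_not_honestSlot {j : ℕ} (h0 : 0 < j) (hn : j ≤ n)
    (h : ¬ HonestSlot w j) : AdversarialSlot w j := by
  refine ⟨⟨j - 1, by omega⟩, by simp; omega, ?_⟩
  by_contra h'
  refine h ⟨⟨j - 1, by omega⟩, by simp; omega, ?_⟩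
  cases hw : w ⟨j - 1, by omega⟩
  · rfl
  · exact absurd hw h'

theorem GoodAt.honestSlot {i : ℕ} (h : GoodAt (List.ofFn w) i) :
    HonestSlot w (i + 1) ∧ HonestSlot w (i + 2) := by
  obtain ⟨x, y, he, rfl, -, -⟩ := h
  have hl : n = x.length + (y.length + 2) := by
    have := congrArg List.length he
    simpa using this
  constructor
  · refine ⟨⟨x.length, by omega⟩, by simp, ?_⟩
    have : (List.ofFn w)[x.length]'(by simp; omega) = H := by simp [he]
    simpa using this
  · refine ⟨⟨x.length + 1, by omega⟩, by simp, ?_⟩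
    have : (List.ofFn w)[x.length + 1]'(by simp; omega) = H := by simp [he]
    simpa using this

theorem bal_take_sub {a b : ℕ} (hab : a ≤ b) (hb : b ≤ n) :
    bal ((List.ofFn w).take b) - bal ((List.ofFn w).take a) =
      (honestCount w a b : ℤ) - advCount w a b := by
  induction b, hab using Nat.le_induction with
  | base => simp [honestCount, advCount]
  | succ b hab ih =>
    have ih := ih (by omega)
    have h1 : (List.ofFn w).take (b + 1) = (List.ofFn w).take b ++ [w ⟨b, by omega⟩] := by
      rw [List.take_succ_eq_append_getElem (by simp; omega)]
      simp
    have h2 : Finset.Ioc a (b + 1) = insert (b + 1) (Finset.Ioc a b) := by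
      ext x; simp; omega
    rw [h1, bal_append]
    unfold honestCount advCount at *
    rw [h2, Finset.filter_insert, Finset.filter_insert]
    cases hw : w ⟨b, by omega⟩
    · have hh : HonestSlot w (b + 1) := ⟨⟨b, by omega⟩, rfl, hw⟩
      rw [if_pos hh, if_neg hh.not_adversarial, Finset.card_insert_of_notMem (by simp)]
      simp [Letter.val]
      omega
    · have hh : AdversarialSlot w (b + 1) := ⟨⟨b, by omega⟩, rfl, hw⟩
      rw [if_neg fun h => h.not_adversarial hh, if_pos hh, Finset.card_insert_of_notMem (by simp)]
      simp [Letter.val]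
      omega

theorem GoodAt.advCount_lt {i a b : ℕ} (h : GoodAt (List.ofFn w) i)
    (hab : a ≤ i ∧ i + 1 ≤ b ∨ a ≤ i + 1 ∧ i + 2 ≤ b) (hb : b ≤ n) :
    advCount w a b < honestCount w a b := by
  have h1 := h.bal_take_lt hab
  have h2 := bal_take_sub (w := w) (a := a) (b := b) (by omega) hb
  omega

/-! Tines -/

theorem Chain.label_nil : Chain.label [] = 0 := rfl

theorem Chain.label_concat (C : Chain) (b : Block) : Chain.label (C ++ [b]) = b.slot := by
  simp [Chain.label]

theorem Chain.eq_concat_of_label_pos {C : Chain} (h : 0 < C.label) :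
    ∃ P b, C = P ++ [b] ∧ b.slot = C.label := by
  rcases List.eq_nil_or_concat C with rfl | ⟨P, b, rfl⟩
  · simp [Chain.label_nil] at h
  · exact ⟨P, b, by simp, by simp [Chain.label]⟩

variable {F : Finset Chain}

theorem IsFork.label_lt_of_mem (hF : IsFork w F) {C E : Chain} (h : C ++ E ∈ F) {b : Block}
    (hb : b ∈ E) : C.label < b.slot := by
  have hs := hF.strict_mono _ h
  rcases List.eq_nil_or_concat C with rfl | ⟨P, c, rfl⟩
  · simp only [List.nil_append, List.pairwise_cons, List.mem_map] at hs
    exact hs.1 _ ⟨b, hb, rfl⟩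
  · simp only [List.concat_eq_append, Chain.label_concat] at *
    simp only [List.append_assoc, List.map_append, List.pairwise_cons, List.pairwise_append] at hs
    refine hs.2.2.1.2.2 c.slot (by simp) b.slot (List.mem_map_of_mem hb)

theorem IsFork.slot_le_label (hF : IsFork w F) {C : Chain} (h : C ∈ F) {b : Block}
    (hb : b ∈ C) : b.slot ≤ C.label := by
  rcases List.eq_nil_or_concat C with rfl | ⟨P, c, rfl⟩
  · simp at hb
  · simp only [List.concat_eq_append, Chain.label_concat, List.mem_append, List.mem_singleton] at *
    rcases hb with hb | rfl
    · have hs := hF.strict_mono _ h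
      simp only [List.map_append, List.pairwise_cons, List.pairwise_append] at hs
      exact (hs.2.2.2 b.slot (List.mem_map_of_mem hb) c.slot (by simp)).le
    · exact le_rfl

theorem IsFork.label_le_of_prefix (hF : IsFork w F) {C D : Chain} (hD : D ∈ F) (h : C <+: D) :
    C.label ≤ D.label := by
  rcases List.eq_nil_or_concat C with rfl | ⟨P, c, rfl⟩
  · simp [Chain.label_nil]
  · rw [List.concat_eq_append, Chain.label_concat]
    exact hF.slot_le_label hD (h.subset (by simp))

theorem IsFork.prefix_of_label_le (hF : IsFork w F) {P Q C : Chain} (hC : C ∈ F) (hP : P <+: C)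
    (hQ : Q <+: C) (h : P.label ≤ Q.label) : P <+: Q := by
  rcases List.prefix_or_prefix_of_prefix hP hQ with h1 | ⟨E, rfl⟩
  · exact h1
  · rcases List.eq_nil_or_concat E with rfl | ⟨E', e, rfl⟩
    · simp
    · have h2 := hF.label_lt_of_mem (hF.prefix_mem _ hC _ hP) (b := e) (by simp)
      rw [List.concat_eq_append, ← List.append_assoc, Chain.label_concat] at h
      omega

/-- Labels increase along tines, so every vertex labelled `s` on either tine already lies on the
common part `V`, where it is unique. -/
theorem not_divergePriorTo (hF : IsFork w F) {s : ℕ} {V C D : Chain} (hC : C ∈ F) (hD : D ∈ F)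
    (hVC : V <+: C) (hVD : V <+: D) (hs : s ≤ V.label) : ¬ DivergePriorTo s C D := by
  have key : ∀ {C : Chain}, C ∈ F → V <+: C → ∀ P : Chain, P <+: C → P.label = s → P <+: V :=
    fun hC hV P hP hl => hF.prefix_of_label_le hC hP hV (hl ▸ hs)
  rintro (⟨P, Q, hP, hQ, hPs, hQs, hne⟩ | h)
  · have h1 := key hC hVC P hP hPs
    have h2 := key hD hVD Q hQ hQs
    have hV := hF.prefix_mem _ hC _ hVC
    exact hne ((hF.prefix_of_label_le hV h1 h2 (by omega)).eq_of_length_le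
      (hF.prefix_of_label_le hV h2 h1 (by omega)).length_le)
  · exact h ⟨fun ⟨P, hP, hl⟩ => ⟨P, (key hC hVC P hP hl).trans hVD, hl⟩,
      fun ⟨P, hP, hl⟩ => ⟨P, (key hD hVD P hP hl).trans hVC, hl⟩⟩

/-- Honest depths grow by at least one per honest slot. -/
theorem IsFork.length_add_honestCount_le (hF : IsFork w F) {C : Chain} (hC : C ∈ F)
    (hC' : C = [] ∨ HonestSlot w C.label) {r L : ℕ} (hCL : C.length ≤ L)
    (hL : ∀ D ∈ F, HonestSlot w D.label → D.label ≤ r → D.length ≤ L) :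
    C.length + honestCount w C.label r ≤ L := by
  choose! v hv using hF.honest_exists
  have hlt : ∀ j, HonestSlot w j → C.label < j → C.length < (v j).length := by
    intro j hj hCj
    rcases hC' with rfl | hC'
    · rw [List.length_nil, List.length_pos_iff]
      intro h0
      have := (hv j hj).2
      rw [h0, Chain.label_nil] at this
      have := hj.pos
      omega
    · exact hF.honest_depth _ _ hC' hj hCj _ hC _ (hv j hj).1 rfl (hv j hj).2
  -- One chosen vertex per honest slot: their depths are distinct and lie in `(C.length, L]`.
  have : honestCount w C.label r ≤ (Finset.Ioc C.length L).card := by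
    refine Finset.card_le_card_of_injOn (fun j => (v j).length) ?_ ?_
    · intro j hj
      simp only [Finset.coe_filter, Finset.mem_Ioc, Set.mem_ofPred_eq, Finset.coe_Ioc,
        Set.mem_Ioc] at hj ⊢
      have := hv j hj.2
      exact ⟨hlt j hj.2 hj.1.1, hL _ this.1 (by rw [this.2]; exact hj.2)
        (by rw [this.2]; exact hj.1.2)⟩
    · intro i hi j hj hij
      simp only [Finset.coe_filter, Finset.mem_Ioc, Set.mem_ofPred_eq] at hi hj hij
      rcases lt_trichotomy i j with h | h | h
      · have := hF.honest_depth i j hi.2 hj.2 h _ (hv i hi.2).1 _ (hv j hj.2).1 (hv i hi.2).2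
          (hv j hj.2).2
        omega
      · exact h
      · have := hF.honest_depth j i hj.2 hi.2 h _ (hv j hj.2).1 _ (hv i hi.2).1 (hv j hj.2).2
          (hv i hi.2).2
        omega
  rw [Nat.card_Ioc] at this
  omega

/-- Blocks of distinct adversarial slots. -/
theorem IsFork.length_le_advCount (hF : IsFork w F) {C E : Chain} (h : C ++ E ∈ F) {r : ℕ}
    (hr : Chain.label (C ++ E) ≤ r) (hE : ∀ b ∈ E, ¬ HonestSlot w b.slot) :
    E.length ≤ advCount w C.label r := by
  have hs := hF.strict_mono _ h
  have hnd : (E.map Block.slot).Nodup := by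
    simp only [List.map_append, List.pairwise_cons, List.pairwise_append] at hs
    exact hs.2.2.1.imp fun h => h.ne
  rw [← List.length_map (f := Block.slot), ← List.toFinset_card_of_nodup hnd]
  refine Finset.card_le_card fun j hj => ?_
  simp only [List.mem_toFinset, List.mem_map] at hj
  obtain ⟨b, hb, rfl⟩ := hj
  have h1 := hF.label_lt_of_mem h hb
  have h2 := hF.slot_le_label h (b := b) (by simp [hb])
  have h3 := hF.label_le _ h
  simp only [Finset.mem_filter, Finset.mem_Ioc]
  exact ⟨⟨h1, by omega⟩, adversarialSlot_of_not_honestSlot (by omega) (by omega) (hE b hb)⟩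

theorem exists_last_honest (w : CharString n) (P : Chain) :
    ∃ C E : Chain, P = C ++ E ∧ (C = [] ∨ HonestSlot w C.label) ∧
      ∀ b ∈ E, ¬ HonestSlot w b.slot := by
  induction P using List.reverseRecOn with
  | nil => exact ⟨[], [], rfl, .inl rfl, by simp⟩
  | append_singleton P b ih =>
    by_cases hb : HonestSlot w b.slot
    · exact ⟨P ++ [b], [], by simp, .inr (by rwa [Chain.label_concat]), by simp⟩
    · obtain ⟨C, E, rfl, h1, h2⟩ := ih
      refine ⟨C, E ++ [b], by simp, h1, fun c hc => ?_⟩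
      rw [List.mem_append, List.mem_singleton] at hc
      rcases hc with hc | rfl
      · exact h2 c hc
      · exact hb

/-- If every interval that contains the slot `j` has an honest majority, then every tine that is at
least as long as all honest vertices seen so far contains a vertex labelled `j`. -/
theorem IsFork.exists_prefix_label_eq (hF : IsFork w F) {j : ℕ} (hj0 : 0 < j)
    (hj : ∀ a b, a < j → j ≤ b → b ≤ n → advCount w a b < honestCount w a b) (m : ℕ) :
    ∀ (P : Chain) (r : ℕ), P.length = m → P ∈ F → P.label ≤ r → j ≤ r → r ≤ n →
      (∀ D ∈ F, HonestSlot w D.label → D.label ≤ r → D.length ≤ P.length) →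
      ∃ Q : Chain, Q <+: P ∧ Q.label = j := by
  induction m using Nat.strong_induction_on with
  | _ m ih =>
  intro P r hm hP hPr hjr hrn hdom
  obtain ⟨C, E, rfl, hC, hE⟩ := exists_last_honest w P
  have hCF : C ∈ F := hF.prefix_mem _ hP _ (by simp)
  rcases lt_trichotomy C.label j with h | h | h
  -- The last honest vertex (or root) precedes `j`: the tail `E` has at most one block per
  -- adversarial slot, yet must gain a level for every honest slot of `(C.label, r]`, where honest
  -- slots prevail.
  · exfalso
    have h1 := hF.length_le_advCount hP hPr hE
    have h2 := hF.length_add_honestCount_le hCF hC (L := (C ++ E).length) (by simp) hdom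
    have h3 := hj C.label r h hjr hrn
    rw [List.length_append] at h2
    omega
  · exact ⟨C, by simp, h⟩
  -- The last honest vertex is beyond `j`: its parent `P'` is at least as deep as all earlier honest
  -- vertices, since honest depths strictly increase, so induction applies to `P'` with the horizon
  -- just before that vertex.
  · obtain ⟨P', b, rfl, hb⟩ := Chain.eq_concat_of_label_pos (hj0.trans h)
    have hh : HonestSlot w (Chain.label (P' ++ [b])) := hC.resolve_left (by simp)
    have hlt : Chain.label P' < Chain.label (P' ++ [b]) :=
      hb ▸ hF.label_lt_of_mem hCF (b := b) (by simp)
    obtain ⟨Q, hQ, hQj⟩ := ih P'.length (by simp at hm; omega) P'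
      (Chain.label (P' ++ [b]) - 1) rfl (hF.prefix_mem _ hCF _ (by simp)) (by omega) (by omega)
      (by have := hF.label_le _ hCF; omega) (by
        intro D hD hDh hDl
        have := hF.honest_depth _ _ hDh hh (by omega) D hD _ hCF rfl rfl
        rw [List.length_append, List.length_singleton] at this
        omega)
    exact ⟨Q, hQ.trans (by simp), hQj⟩

/-- All maximum-length tines of a fork meet in a vertex labelled by the first slot of a good pair. -/
theorem GoodAt.exists_common_prefix {R : TieBreakingRule} (hF : IsFork w F)
    (hR : FollowsRule R w F) {i : ℕ} (hi : GoodAt (List.ofFn w) i) :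
    ∃ V : Chain, V.label = i + 1 ∧ ∀ C ∈ longest F, V <+: C := by
  obtain ⟨hh1, hh2⟩ := hi.honestSlot
  set B := longest (before F (i + 2)) with hB
  -- A longest tine before slot `i + 2` contains slot `i + 1`, the last label available, and so ends
  -- there.
  have hlab : ∀ C ∈ B, C.label = i + 1 := by
    intro C hC
    simp only [hB, longest, before, Finset.mem_filter] at hC
    obtain ⟨⟨hCF, hCl⟩, hmax⟩ := hC
    obtain ⟨Q, hQ, hQl⟩ := hF.exists_prefix_label_eq (j := i + 1) (by omega)
      (fun a b ha hb hn => hi.advCount_lt (.inl ⟨by omega, hb⟩) hn) _ C (i + 1) rfl hCF (by omega)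
      le_rfl hh1.le (fun D hD _ hDl => hmax D ⟨hD, by omega⟩)
    have := hF.label_le_of_prefix hCF hQ
    omega
  have hne : B.Nonempty := by
    obtain ⟨C, hC, hmax⟩ := Finset.exists_max_image (before F (i + 2)) List.length
      ⟨[], by simp [before, hF.root_mem, Chain.label_nil]⟩
    exact ⟨C, by simp only [hB, longest, Finset.mem_filter]; exact ⟨hC, hmax⟩⟩
  refine ⟨R.choose B, hlab _ (R.choose_mem _ hne), fun C hC => ?_⟩
  simp only [longest, Finset.mem_filter] at hC
  obtain ⟨Q, hQ, hQl⟩ := hF.exists_prefix_label_eq (j := i + 2) (by omega)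
      (fun a b ha hb hn => hi.advCount_lt (.inr ⟨by omega, hb⟩) hn) _ C n rfl hC.1
      (hF.label_le _ hC.1) hh2.le le_rfl (fun D hD _ _ => hC.2 D hD)
  obtain ⟨P, b, rfl, hb⟩ := Chain.eq_concat_of_label_pos (C := Q) (by omega)
  -- All candidates have the honest label `i + 1`, so there is no tie and the rule determines the
  -- parent of the vertex labelled `i + 2`.
  have := hR (i + 2) hh2 (fun ⟨D, hD, hA⟩ => by
    rw [hlab D hD] at hA
    exact hh1.not_adversarial hA) P b (hF.prefix_mem _ hC.1 _ hQ) (by omega)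
  rw [hB, ← this]
  exact (List.prefix_append P [b]).trans hQ

end Count

/-! ### Settlement violations: no good pairs, and monotonicity -/

/-- A settlement violation excludes good pairs in the window of `k` slots that starts at `s`. -/
theorem NotSettled.not_goodAt {R : TieBreakingRule} {s k T : ℕ} {w : CharString T}
    (h : NotSettled R s k w) :
    s ≠ 0 ∧ s + k ≤ T ∧ ∀ i, s ≤ i + 1 → i + 1 < s + k → ¬ GoodAt (List.ofFn w) i := by
  obtain ⟨t, htT, hst, F, hF, hR, C, hC, D, hD, hdiv⟩ := h
  have hCF : C ∈ F := (Finset.mem_filter.1 hC).1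
  have hDF : D ∈ F := (Finset.mem_filter.1 hD).1
  refine ⟨?_, hst.trans htT, fun i h1 h2 hi => ?_⟩
  -- For `s = 0` the root is already a sufficient common vertex.
  · rintro rfl
    exact not_divergePriorTo hF (V := []) hCF hDF (by simp) (by simp) (by simp) hdiv
  · have hi' : GoodAt (List.ofFn (Fin.take t htT w)) i := by
      rw [Fin.ofFn_take_eq_take_ofFn]
      exact hi.take (by omega) (by simpa using htT)
    obtain ⟨V, hV, hpre⟩ := hi'.exists_common_prefix hF hR
    exact not_divergePriorTo hF hCF hDF (hpre C hC) (hpre D hD) (by omega) hdiv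

theorem HonestSlot.mono {n : ℕ} {w w' : CharString n} (h : w ≤ w') {j : ℕ}
    (hj : HonestSlot w' j) : HonestSlot w j := by
  obtain ⟨i, hi, hH⟩ := hj
  refine ⟨i, hi, ?_⟩
  have h1 : (w i).toNat ≤ (w' i).toNat := h i
  rw [hH] at h1
  cases hw : w i
  · rfl
  · simp [hw, Letter.toNat] at h1

theorem AdversarialSlot.mono {n : ℕ} {w w' : CharString n} (h : w ≤ w') {j : ℕ}
    (hj : AdversarialSlot w j) : AdversarialSlot w' j := by
  obtain ⟨i, hi, hA⟩ := hj
  refine ⟨i, hi, ?_⟩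
  have h1 : (w i).toNat ≤ (w' i).toNat := h i
  rw [hA] at h1
  cases hw : w' i
  · simp [hw, Letter.toNat] at h1
  · rfl

/-- The same fork and tines serve as witness for `w'`: honest slots become fewer and adversarial
ties more frequent, so every requirement on the fork weakens. -/
theorem isUpperSet_notSettled (R : TieBreakingRule) (s k T : ℕ) :
    IsUpperSet {w : CharString T | NotSettled R s k w} := by
  rintro w w' hw ⟨t, ht, hst, F, hF, hR, hC⟩
  have hle : Fin.take t ht w ≤ Fin.take t ht w' := fun i => hw _
  exact ⟨t, ht, hst, F,
    ⟨hF.root_mem, hF.prefix_mem, hF.label_le, hF.strict_mono,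
      fun j hj => hF.honest_exists j (hj.mono hle),
      fun i j hi hj => hF.honest_depth i j (hi.mono hle) (hj.mono hle)⟩,
    fun j hj htie => hR j (hj.mono hle) fun ⟨C, hC, hA⟩ => htie ⟨C, hC, hA.mono hle⟩, hC⟩

/-! Random strings with independent letters -/

/-- The expectation of `f` over strings of `n` independent letters, each equal to `H` with
probability `p` and to `A` with probability `q`. -/
def expect (p q : ℝ) : ℕ → (List Letter → ℝ) → ℝ
  | 0, f => f []
  | n + 1, f => p * expect p q n (fun l => f (H :: l)) + q * expect p q n (fun l => f (A :: l))

section Expect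

variable {p q : ℝ}

theorem expect_mono (hp : 0 ≤ p) (hq : 0 ≤ q) {n : ℕ} {f g : List Letter → ℝ}
    (h : ∀ l, l.length = n → f l ≤ g l) : expect p q n f ≤ expect p q n g := by
  induction n generalizing f g with
  | zero => exact h [] rfl
  | succ n ih =>
    have h1 : expect p q n (fun l => f (H :: l)) ≤ expect p q n (fun l => g (H :: l)) :=
      ih fun l hl => h _ (by simp [hl])
    have h2 : expect p q n (fun l => f (A :: l)) ≤ expect p q n (fun l => g (A :: l)) :=
      ih fun l hl => h _ (by simp [hl])
    exact add_le_add (mul_le_mul_of_nonneg_left h1 hp) (mul_le_mul_of_nonneg_left h2 hq)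

theorem expect_congr {n : ℕ} {f g : List Letter → ℝ} (h : ∀ l, l.length = n → f l = g l) :
    expect p q n f = expect p q n g := by
  induction n generalizing f g with
  | zero => exact h [] rfl
  | succ n ih =>
    have h1 : expect p q n (fun l => f (H :: l)) = expect p q n (fun l => g (H :: l)) :=
      ih fun l hl => h _ (by simp [hl])
    have h2 : expect p q n (fun l => f (A :: l)) = expect p q n (fun l => g (A :: l)) :=
      ih fun l hl => h _ (by simp [hl])
    simp only [expect, h1, h2]

theorem expect_const (hpq : p + q = 1) (n : ℕ) (c : ℝ) : expect p q n (fun _ => c) = c := by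
  induction n with
  | zero => rfl
  | succ n ih => rw [expect, ih, ← add_mul, hpq, one_mul]

theorem expect_add (n : ℕ) (f g : List Letter → ℝ) :
    expect p q n (fun l => f l + g l) = expect p q n f + expect p q n g := by
  induction n generalizing f g with
  | zero => rfl
  | succ n ih => simp only [expect, ih]; ring

theorem expect_const_mul (n : ℕ) (c : ℝ) (f : List Letter → ℝ) :
    expect p q n (fun l => c * f l) = c * expect p q n f := by
  induction n generalizing f with
  | zero => rfl
  | succ n ih => simp only [expect, ih]; ring

theorem expect_sum {ι : Type*} (hpq : p + q = 1) (n : ℕ) (s : Finset ι)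
    (f : ι → List Letter → ℝ) :
    expect p q n (fun l => ∑ i ∈ s, f i l) = ∑ i ∈ s, expect p q n (f i) := by
  classical
  induction s using Finset.induction_on with
  | empty => simp [expect_const hpq]
  | insert a s ha ih => simp only [Finset.sum_insert ha, expect_add, ih]

theorem expect_append (m n : ℕ) (f : List Letter → ℝ) :
    expect p q (m + n) f = expect p q m (fun x => expect p q n (fun y => f (x ++ y))) := by
  induction m generalizing f with
  | zero => simp [expect]
  | succ m ih =>
    rw [show m + 1 + n = m + n + 1 by omega]
    simp only [expect, ih, List.cons_append]

open Classical in
/-- The probability of an event under `expect`. -/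
noncomputable def prob (p q : ℝ) (n : ℕ) (P : List Letter → Prop) : ℝ :=
  expect p q n (fun l => if P l then 1 else 0)

theorem prob_succ (n : ℕ) (P : List Letter → Prop) :
    prob p q (n + 1) P =
      p * prob p q n (fun l => P (H :: l)) + q * prob p q n (fun l => P (A :: l)) := rfl

theorem prob_mono (hp : 0 ≤ p) (hq : 0 ≤ q) {n : ℕ} {P Q : List Letter → Prop}
    (h : ∀ l, l.length = n → P l → Q l) : prob p q n P ≤ prob p q n Q := by
  refine expect_mono hp hq fun l hl => ?_
  by_cases hP : P l
  · rw [if_pos hP, if_pos (h l hl hP)]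
  · rw [if_neg hP]; split_ifs <;> norm_num

theorem prob_le_one (hp : 0 ≤ p) (hq : 0 ≤ q) (hpq : p + q = 1) (n : ℕ)
    (P : List Letter → Prop) : prob p q n P ≤ 1 := by
  rw [← expect_const hpq n 1]
  refine expect_mono hp hq fun l _ => ?_
  split_ifs <;> norm_num

theorem prob_not (hpq : p + q = 1) (n : ℕ) (P : List Letter → Prop) :
    prob p q n (fun l => ¬ P l) = 1 - prob p q n P := by
  rw [eq_sub_iff_add_eq, prob, prob, ← expect_add]
  refine (expect_congr fun l _ => ?_).trans (expect_const hpq n 1)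
  by_cases h : P l <;> simp [h]

theorem prob_exists_le {ι : Type*} (hp : 0 ≤ p) (hq : 0 ≤ q) (hpq : p + q = 1) (n : ℕ)
    (s : Finset ι) (P : ι → List Letter → Prop) :
    prob p q n (fun l => ∃ i ∈ s, P i l) ≤ ∑ i ∈ s, prob p q n (P i) := by
  classical
  simp only [prob]
  rw [← expect_sum hpq]
  refine expect_mono hp hq fun l _ => ?_
  have hnn : ∀ i ∈ s, (0 : ℝ) ≤ if P i l then 1 else 0 := fun i _ => by split_ifs <;> norm_num
  split_ifs with h
  · obtain ⟨i, hi, hP⟩ := h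
    calc (1 : ℝ) = if P i l then 1 else 0 := by rw [if_pos hP]
      _ ≤ _ := Finset.single_le_sum hnn hi
  · exact Finset.sum_nonneg hnn

/-- An event about the middle part of a random string. -/
theorem prob_middle (hpq : p + q = 1) (a n b : ℕ) (P : List Letter → Prop) :
    prob p q (a + n + b) (fun l => P ((l.drop a).take n)) = prob p q n P := by
  classical
  rw [prob, expect_append, expect_append]
  rw [← expect_const (p := p) (q := q) hpq a (prob p q n P), prob]
  refine expect_congr fun x hx => expect_congr fun y hy => ?_
  refine (expect_congr (g := fun _ => ite (P y) 1 0) fun z hz => ?_).trans (expect_const hpq b _)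
  have : ((x ++ y ++ z).drop a).take n = y := by
    subst hx hy
    simp
  simp only [this]

theorem prob_snoc (n : ℕ) (P : List Letter → Prop) :
    prob p q (n + 1) P =
      p * prob p q n (fun l => P (l ++ [H])) + q * prob p q n (fun l => P (l ++ [A])) := by
  simp only [prob]
  rw [expect_append, ← expect_const_mul, ← expect_const_mul, ← expect_add]
  simp only [expect]

end Expect

/-! The gap between the walk and its running maximum -/

/-- One step of the walk seen from its running maximum. -/
def gapStep (g : ℕ) : Letter → ℕ
  | .H => g - 1
  | .A => g + 1

/-- The distance of the walk from its running maximum. -/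
def gap (x : List Letter) : ℕ := x.foldl gapStep 0

@[simp] theorem gap_concat (x : List Letter) (a : Letter) : gap (x ++ [a]) = gapStep (gap x) a := by
  simp [gap]

/-- In particular, gap zero yields the condition on the past in `GoodAt`. -/
theorem neg_bal_le_gap {x z : List Letter} (h : z <:+ x) : -bal z ≤ gap x := by
  induction x using List.reverseRecOn generalizing z with
  | nil => simp [List.suffix_nil.1 h]
  | append_singleton x a ih =>
    rcases List.eq_nil_or_concat z with rfl | ⟨z, b, rfl⟩
    · simp
    · rw [List.concat_eq_append] at *
      obtain ⟨u, hu⟩ := h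
      rw [← List.append_assoc] at hu
      obtain ⟨hu1, hu2⟩ := List.append_inj' hu rfl
      have := ih ⟨u, hu1⟩
      obtain rfl : b = a := by simpa using hu2
      rw [gap_concat]
      cases b <;> simp [Letter.val, gapStep] <;> omega

theorem gap_le_length (x : List Letter) : gap x ≤ x.length := by
  induction x using List.reverseRecOn with
  | nil => simp [gap]
  | append_singleton x a ih =>
    cases a <;> simp [gapStep] <;> omega

/-- The geometric tail with ratio `r = q / p` is preserved by a step of the reflected walk because
`p * r ^ 2 + q = r`; the walk starts at gap zero, below this tail. -/
theorem prob_le_gap {p q : ℝ} (hp : 0 < p) (hq : 0 ≤ q) (hpq : p + q = 1) (n x : ℕ) :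
    prob p q n (fun l => x ≤ gap l) ≤ (q / p) ^ x := by
  induction n generalizing x with
  | zero =>
    rcases Nat.eq_zero_or_pos x with rfl | hx
    · simpa using prob_le_one hp.le hq hpq _ _
    · have : prob p q 0 (fun l => x ≤ gap l) = 0 := by
        simp [prob, expect, gap]; omega
      rw [this]; positivity
  | succ n ih =>
    rcases x with _ | x
    · simpa using prob_le_one hp.le hq hpq _ _
    · rw [prob_snoc]
      have h1 : prob p q n (fun l => x + 1 ≤ gap (l ++ [H])) ≤ (q / p) ^ (x + 2) :=
        (prob_mono hp.le hq fun l _ h => by simp [gapStep] at h; omega).trans (ih (x + 2))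
      have h2 : prob p q n (fun l => x + 1 ≤ gap (l ++ [A])) ≤ (q / p) ^ x :=
        (prob_mono hp.le hq fun l _ h => by simp [gapStep] at h; omega).trans (ih x)
      calc _ ≤ p * (q / p) ^ (x + 2) + q * (q / p) ^ x :=
            add_le_add (mul_le_mul_of_nonneg_left h1 hp.le) (mul_le_mul_of_nonneg_left h2 hq)
        _ = (q / p) ^ (x + 1) * (q + p) := by
            have hr : q = q / p * p := (div_mul_cancel₀ q hp.ne').symm
            generalize q / p = r at hr
            subst hr
            ring
        _ = (q / p) ^ (x + 1) := by rw [add_comm q p, hpq, mul_one]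

theorem expect_pow_gap_le {p q φ : ℝ} (hp : 0 < p) (hq : 0 ≤ q) (hpq : p + q = 1) (hφ : 1 ≤ φ)
    (hφq : φ * (q / p) < 1) (n : ℕ) :
    expect p q n (fun l => φ ^ gap l) ≤ 1 + (φ - 1) * (q / p) / (1 - φ * (q / p)) := by
  classical
  have hr : 0 ≤ q / p := by positivity
  -- Summation by parts writes `φ ^ gap` through the tail events, whose probabilities are known.
  have h1 : expect p q n (fun l => φ ^ gap l) =
      expect p q n (fun l => 1 + ∑ x ∈ Finset.range n,
        ((φ - 1) * φ ^ x) * if x + 1 ≤ gap l then 1 else 0) := by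
    refine expect_congr fun l hl => ?_
    have hg : gap l ≤ n := hl ▸ gap_le_length l
    have h2 : ∑ x ∈ Finset.range n, ((φ - 1) * φ ^ x) * (if x + 1 ≤ gap l then (1 : ℝ) else 0) =
        ∑ x ∈ Finset.range (gap l), (φ - 1) * φ ^ x := by
      simp only [mul_ite, mul_one, mul_zero]
      rw [← Finset.sum_filter]
      refine Finset.sum_congr ?_ fun _ _ => rfl
      ext x
      simp only [Finset.mem_filter, Finset.mem_range]
      omega
    rw [h2, ← Finset.mul_sum, mul_geom_sum]
    ring
  rw [h1, expect_add, expect_const hpq, expect_sum hpq]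
  gcongr
  calc ∑ x ∈ Finset.range n, expect p q n
        (fun l => ((φ - 1) * φ ^ x) * if x + 1 ≤ gap l then 1 else 0)
      ≤ ∑ x ∈ Finset.range n, (φ - 1) * (q / p) * (φ * (q / p)) ^ x := by
        refine Finset.sum_le_sum fun x _ => ?_
        rw [expect_const_mul]
        have h3 : expect p q n (fun l => if x + 1 ≤ gap l then (1 : ℝ) else 0) ≤
            (q / p) ^ (x + 1) := by
          convert prob_le_gap hp hq hpq n (x + 1)
          simp [prob]
        calc _ ≤ ((φ - 1) * φ ^ x) * (q / p) ^ (x + 1) :=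
              mul_le_mul_of_nonneg_left h3 (mul_nonneg (by linarith) (by positivity))
          _ = _ := by rw [mul_pow]; ring
    _ ≤ (φ - 1) * (q / p) / (1 - φ * (q / p)) := by
        rw [← Finset.mul_sum, div_eq_mul_inv _ (1 - φ * (q / p))]
        refine mul_le_mul_of_nonneg_left ?_ (mul_nonneg (by linarith) hr)
        have h4 := geom_sum_mul_neg (φ * (q / p)) n
        rw [← one_div, le_div_iff₀ (by linarith), h4]
        have : 0 ≤ (φ * (q / p)) ^ n := by positivity
        linarith

/-! Exponential decay of the probability that a window contains no good pair -/

/-- Per-letter rates for which `φ ^ gap`, and `φ ^ _ * ψ ^ height` for a pending candidate pair, are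
supermartingales that decay by the factor `κ` in each step. -/
structure DecayRates (p q φ ψ κ : ℝ) : Prop where
  p_pos : 0 < p
  q_nonneg : 0 ≤ q
  add_eq_one : p + q = 1
  one_le_φ : 1 ≤ φ
  ψ_pos : 0 < ψ
  κ_pos : 0 < κ
  κ_le_one : κ ≤ 1
  gap_step : p + q * φ ^ 2 ≤ φ * κ
  trial_step : φ * (q + p * q + p ^ 2 * ψ) ≤ κ ^ 2
  pending_step : φ * (p * ψ ^ 2 + q) ≤ ψ * κ

/-- There is no good pair that begins in the first `n` letters after the prefix `x`. -/
def NoGood (x : List Letter) (n : ℕ) (l : List Letter) : Prop :=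
  ∀ i, x.length ≤ i → i < x.length + n → ¬ GoodAt (x ++ l) i

theorem NoGood.cons {x l : List Letter} {a : Letter} {n : ℕ} (h : NoGood x n (a :: l)) :
    NoGood (x ++ [a]) (n - 1) l := by
  intro i h1 h2
  have := h i (by simp at h1; omega) (by simp at h1 h2; omega)
  simpa using this

/-- At gap zero the past condition holds, so the candidate `H H` can fail only through a later drop
below its level. The height is written `(0 : ℕ)` to match the general pending state. -/
theorem NoGood.exists_bal_neg {x l : List Letter} {n : ℕ} (h : NoGood x n (H :: H :: l))
    (hx : gap x = 0) (hn : 0 < n) : ∃ z, z <+: l ∧ ((0 : ℕ) : ℤ) + bal z < 0 := by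
  by_contra! hz
  refine h x.length le_rfl (by omega) ⟨x, l, rfl, rfl, fun z h' => ?_, fun z h' => ?_⟩
  · have := neg_bal_le_gap h'
    omega
  · simpa using hz z h'

theorem exists_prefix_cons {P : List Letter → Prop} {a : Letter} {l : List Letter}
    (h : ∃ z, z <+: a :: l ∧ P z) (h0 : ¬ P []) : ∃ z, z <+: l ∧ P (a :: z) := by
  obtain ⟨z, hz, hP⟩ := h
  rcases z with _ | ⟨b, z⟩
  · exact absurd hP h0
  · rw [List.cons_prefix_cons] at hz
    obtain ⟨rfl, hz⟩ := hz
    exact ⟨z, hz, hP⟩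

namespace DecayRates

variable {p q φ ψ κ : ℝ}

/-- `ψ` to the height above the ruin level is a supermartingale, since `pending_step` with `φ ≥ 1 ≥
κ` gives `p * ψ ^ 2 + q ≤ ψ`. This covers a candidate still pending when the window ends. -/
theorem ruin (D : DecayRates p q φ ψ κ) (N h : ℕ) :
    prob p q N (fun l => ∃ z, z <+: l ∧ (h : ℤ) + bal z < 0) ≤ ψ ^ (h + 1) := by
  have hψ := D.ψ_pos
  have hp := D.p_pos.le
  have hq := D.q_nonneg
  induction N generalizing h with
  | zero =>
    have : prob p q 0 (fun l => ∃ z, z <+: l ∧ (h : ℤ) + bal z < 0) = 0 := by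
      simp only [prob, expect]
      rw [if_neg]
      rintro ⟨z, hz, h1⟩
      simp [List.prefix_nil.1 hz] at h1
      omega
    rw [this]; positivity
  | succ N ih =>
    rw [prob_succ]
    have hstep : p * ψ ^ 2 + q ≤ ψ := by
      have h1 := D.pending_step
      have h2 := D.one_le_φ
      have h3 := D.κ_le_one
      have h4 : 0 ≤ p * ψ ^ 2 + q := by positivity
      nlinarith
    have h1 : prob p q N (fun l => ∃ z, z <+: H :: l ∧ (h : ℤ) + bal z < 0) ≤ ψ ^ (h + 2) := by
      refine (prob_mono hp hq fun l _ hl => ?_).trans (ih (h + 1))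
      obtain ⟨z, hz, hb⟩ := exists_prefix_cons hl (by simp)
      refine ⟨z, hz, ?_⟩
      simp [Letter.val] at hb ⊢
      omega
    have h2 : prob p q N (fun l => ∃ z, z <+: A :: l ∧ (h : ℤ) + bal z < 0) ≤ ψ ^ h := by
      rcases h with _ | h
      · simpa using prob_le_one hp hq D.add_eq_one _ _
      · refine (prob_mono hp hq fun l _ hl => ?_).trans (ih h)
        obtain ⟨z, hz, hb⟩ := exists_prefix_cons hl (by simp; omega)
        refine ⟨z, hz, ?_⟩
        simp [Letter.val] at hb ⊢
        omega
    calc _ ≤ p * ψ ^ (h + 2) + q * ψ ^ h :=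
          add_le_add (mul_le_mul_of_nonneg_left h1 hp) (mul_le_mul_of_nonneg_left h2 hq)
      _ = ψ ^ h * (p * ψ ^ 2 + q) := by ring
      _ ≤ ψ ^ h * ψ := by gcongr
      _ = ψ ^ (h + 1) := (pow_succ _ _).symm

theorem pow_sub_two_le (D : DecayRates p q φ ψ κ) {n : ℕ} : κ ^ (n - 2) * κ ^ 2 ≤ κ ^ n := by
  rw [← pow_add]
  exact pow_le_pow_of_le_one D.κ_pos.le D.κ_le_one (by omega)

/-- The two bounds are the searching state and the pending state, where a candidate must still fail
from height `h`; they are proved jointly because each leads to the other. In the pending state `G`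
may grow by one per letter and bounds `gap x + h`, so it controls the gap at which the search
resumes. The condition `n + 1 ≤ N` leaves room for the second letter of a pair that begins at the
end of the window. -/
theorem noGood_bound (D : DecayRates p q φ ψ κ) (N : ℕ) :
    (∀ x n, n = 0 ∨ n + 1 ≤ N → prob p q N (NoGood x n) ≤ φ ^ gap x * κ ^ n) ∧
    (∀ x n h G, n = 0 ∨ n + 1 ≤ N → gap x + h ≤ G →
      prob p q N (fun l => NoGood x n l ∧ ∃ z, z <+: l ∧ (h : ℤ) + bal z < 0) ≤
        φ ^ (G + 1) * ψ ^ (h + 1) * κ ^ n) := by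
  have hψ := D.ψ_pos
  have hκ := D.κ_pos
  have hp := D.p_pos.le
  have hq := D.q_nonneg
  have hφ := D.one_le_φ
  have hφ0 : 0 < φ := by linarith
  induction N using Nat.strong_induction_on with
  | _ N ih =>
  constructor
  · intro x n hn
    rcases Nat.eq_zero_or_pos n with rfl | hn0
    · have := one_le_pow₀ hφ (n := gap x)
      simpa using (prob_le_one hp hq D.add_eq_one N _).trans this
    obtain ⟨N, rfl⟩ : ∃ M, N = M + 2 := ⟨N - 2, by omega⟩
    have hA : prob p q (N + 1) (fun l => NoGood x n (A :: l)) ≤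
        φ ^ (gap x + 1) * κ ^ (n - 1) := by
      refine (prob_mono hp hq fun l _ hl => hl.cons).trans ?_
      simpa [gapStep] using (ih (N + 1) (by omega)).1 (x ++ [A]) (n - 1) (by omega)
    -- At gap zero up to two letters are read: `A` and `H A` lead to gap one, while `H H` opens a
    -- candidate. At positive gap a single letter moves the gap.
    rcases Nat.eq_zero_or_pos (gap x) with hg | hg
    · have hHA : prob p q N (fun l => NoGood x n (H :: A :: l)) ≤ φ * κ ^ (n - 2) := by
        refine (prob_mono hp hq fun l _ hl => hl.cons.cons).trans ?_
        have := (ih N (by omega)).1 (x ++ [H] ++ [A]) (n - 1 - 1) (by omega)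
        rwa [gap_concat, gap_concat, hg, Nat.sub_sub, gapStep, gapStep, pow_one] at this
      have hHH : prob p q N (fun l => NoGood x n (H :: H :: l)) ≤ φ * ψ * κ ^ (n - 2) := by
        have := (ih N (by omega)).2 (x ++ [H] ++ [H]) (n - 1 - 1) 0 0 (by omega)
          (by rw [gap_concat, gap_concat, hg]; simp [gapStep])
        rw [Nat.sub_sub, zero_add, pow_one, pow_one] at this
        exact (prob_mono hp hq fun l _ hl =>
          ⟨hl.cons.cons, hl.exists_bal_neg hg hn0⟩).trans this
      have hκ1 : κ ^ (n - 1) ≤ κ ^ (n - 2) :=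
        pow_le_pow_of_le_one hκ.le D.κ_le_one (by omega)
      rw [hg] at hA ⊢
      rw [prob_succ, prob_succ]
      calc _ ≤ p * (p * (φ * ψ * κ ^ (n - 2)) + q * (φ * κ ^ (n - 2))) +
            q * (φ ^ (0 + 1) * κ ^ (n - 2)) := by
            refine add_le_add (mul_le_mul_of_nonneg_left (add_le_add
              (mul_le_mul_of_nonneg_left hHH hp) (mul_le_mul_of_nonneg_left hHA hq)) hp)
              (mul_le_mul_of_nonneg_left (hA.trans ?_) hq)
            gcongr
        _ = κ ^ (n - 2) * (φ * (q + p * q + p ^ 2 * ψ)) := by ring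
        _ ≤ κ ^ (n - 2) * κ ^ 2 :=
            mul_le_mul_of_nonneg_left D.trial_step (by positivity)
        _ ≤ φ ^ 0 * κ ^ n := by simpa using D.pow_sub_two_le
    · obtain ⟨g, hg'⟩ := Nat.exists_eq_add_of_le' hg
      have hH : prob p q (N + 1) (fun l => NoGood x n (H :: l)) ≤ φ ^ g * κ ^ (n - 1) := by
        refine (prob_mono hp hq fun l _ hl => hl.cons).trans ?_
        simpa [gapStep, hg'] using (ih (N + 1) (by omega)).1 (x ++ [H]) (n - 1) (by omega)
      rw [hg'] at hA ⊢
      rw [prob_succ]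
      calc _ ≤ p * (φ ^ g * κ ^ (n - 1)) + q * (φ ^ (g + 1 + 1) * κ ^ (n - 1)) :=
            add_le_add (mul_le_mul_of_nonneg_left hH hp) (mul_le_mul_of_nonneg_left hA hq)
        _ = φ ^ g * κ ^ (n - 1) * (p + q * φ ^ 2) := by ring
        _ ≤ φ ^ g * κ ^ (n - 1) * (φ * κ) :=
            mul_le_mul_of_nonneg_left D.gap_step (by positivity)
        _ = φ ^ (g + 1) * (κ ^ (n - 1) * κ) := by ring
        _ = φ ^ (g + 1) * κ ^ n := by rw [← pow_succ, Nat.sub_add_cancel hn0]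
  · intro x n h G hn hG
    rcases Nat.eq_zero_or_pos n with rfl | hn0
    · refine (prob_mono hp hq fun l _ hl => hl.2).trans ((D.ruin N h).trans ?_)
      rw [pow_zero, mul_one]
      exact le_mul_of_one_le_left (by positivity) (one_le_pow₀ hφ)
    obtain ⟨N, rfl⟩ : ∃ M, N = M + 1 := ⟨N - 1, by omega⟩
    have hH : prob p q N (fun l => NoGood x n (H :: l) ∧
        ∃ z, z <+: H :: l ∧ (h : ℤ) + bal z < 0) ≤ φ ^ (G + 2) * ψ ^ (h + 2) * κ ^ (n - 1) := by
      refine (prob_mono hp hq fun l _ hl => ⟨hl.1.cons, ?_⟩).trans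
        ((ih N (by omega)).2 (x ++ [H]) (n - 1) (h + 1) (G + 1) (by omega)
          (by simp [gapStep]; omega))
      obtain ⟨z, hz, hb⟩ := exists_prefix_cons hl.2 (by simp)
      refine ⟨z, hz, ?_⟩
      simp [Letter.val] at hb ⊢
      omega
    have hA : prob p q N (fun l => NoGood x n (A :: l) ∧
        ∃ z, z <+: A :: l ∧ (h : ℤ) + bal z < 0) ≤ φ ^ (G + 2) * ψ ^ h * κ ^ (n - 1) := by
      -- At height zero an `A` kills the candidate, and the search resumes at gap at most `G + 1`.
      rcases h with _ | h
      · refine (prob_mono hp hq fun l _ hl => hl.1.cons).trans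
          (((ih N (by omega)).1 (x ++ [A]) (n - 1) (by omega)).trans ?_)
        rw [gap_concat, gapStep, pow_zero, mul_one]
        exact mul_le_mul_of_nonneg_right (pow_le_pow_right₀ hφ (by omega)) (by positivity)
      · refine (prob_mono hp hq fun l _ hl => ⟨hl.1.cons, ?_⟩).trans
          ((ih N (by omega)).2 (x ++ [A]) (n - 1) h (G + 1) (by omega)
            (by simp [gapStep]; omega))
        obtain ⟨z, hz, hb⟩ := exists_prefix_cons hl.2 (by simp; omega)
        refine ⟨z, hz, ?_⟩
        simp [Letter.val] at hb ⊢
        omega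
    rw [prob_succ]
    calc _ ≤ p * (φ ^ (G + 2) * ψ ^ (h + 2) * κ ^ (n - 1)) +
          q * (φ ^ (G + 2) * ψ ^ h * κ ^ (n - 1)) :=
          add_le_add (mul_le_mul_of_nonneg_left hH hp) (mul_le_mul_of_nonneg_left hA hq)
      _ = φ ^ (G + 1) * ψ ^ h * κ ^ (n - 1) * (φ * (p * ψ ^ 2 + q)) := by ring
      _ ≤ φ ^ (G + 1) * ψ ^ h * κ ^ (n - 1) * (ψ * κ) :=
          mul_le_mul_of_nonneg_left D.pending_step (by positivity)
      _ = φ ^ (G + 1) * ψ ^ (h + 1) * (κ ^ (n - 1) * κ) := by ring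
      _ = φ ^ (G + 1) * ψ ^ (h + 1) * κ ^ n := by rw [← pow_succ, Nat.sub_add_cancel hn0]

end DecayRates

/-! ### Explicit rates and the resulting bound -/

/-- With `1 - ψ` of order `ε`, the slack in `pending_step` is of order `ε ^ 2`, which allows `φ - 1`
of that order. The gap drifts down at speed `ε`, so `gap_step` gains order `ε * (φ - 1)`: this is
the source of `ε ^ 3`. The slack in `trial_step` is of order `ε`. -/
theorem decayRates {ε : ℝ} (h0 : 0 < ε) (h1 : ε < 1) :
    DecayRates ((1 + ε) / 2) ((1 - ε) / 2) (1 + ε ^ 2 / 16) (1 - ε / 2) (1 - ε ^ 3 / 64) where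
  p_pos := by positivity
  q_nonneg := by linarith
  add_eq_one := by ring
  one_le_φ := by have := sq_nonneg ε; linarith
  ψ_pos := by linarith
  κ_pos := by have := pow_le_one₀ h0.le h1.le (n := 3); linarith
  κ_le_one := by have := pow_pos h0 3; linarith
  gap_step := by
    have h2 : ε ^ 2 ≤ 1 := pow_le_one₀ h0.le h1.le
    have h3 : 0 < ε ^ 3 := pow_pos h0 3
    have h4 : ε * (1 - ε) ≤ 1 / 4 := by nlinarith [sq_nonneg (ε - 1 / 2)]
    have h5 : (1 + ε ^ 2 / 16) * (1 - ε ^ 3 / 64) -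
        ((1 + ε) / 2 + (1 - ε) / 2 * (1 + ε ^ 2 / 16) ^ 2) =
        ε ^ 3 * (1 / 16 - 1 / 64 - ε ^ 2 / 1024 - ε * (1 - ε) / 512) := by ring
    have h6 : 0 ≤ ε ^ 3 * (1 / 16 - 1 / 64 - ε ^ 2 / 1024 - ε * (1 - ε) / 512) :=
      mul_nonneg h3.le (by linarith)
    linarith
  trial_step := by
    have h5 : (1 - ε ^ 3 / 64) ^ 2 - (1 + ε ^ 2 / 16) * ((1 - ε) / 2 + (1 + ε) / 2 * ((1 - ε) / 2) +
        ((1 + ε) / 2) ^ 2 * (1 - ε / 2)) =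
        ε * ((1 + ε) ^ 2 / 8 + ε ^ 2 * (1 + ε) ^ 2 / 128 - ε / 16 - ε ^ 2 / 32 +
          ε ^ 5 / 4096) := by ring
    have h6 : 0 ≤ ε * ((1 + ε) ^ 2 / 8 + ε ^ 2 * (1 + ε) ^ 2 / 128 - ε / 16 - ε ^ 2 / 32 +
          ε ^ 5 / 4096) := by
      have h7 : 0 ≤ ε ^ 2 * (1 + ε) ^ 2 / 128 := by positivity
      have h8 : 0 ≤ ε ^ 5 / 4096 := by positivity
      refine mul_nonneg h0.le ?_
      nlinarith
    linarith
  pending_step := by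
    have h5 : (1 - ε / 2) * (1 - ε ^ 3 / 64) -
        (1 + ε ^ 2 / 16) * ((1 + ε) / 2 * (1 - ε / 2) ^ 2 + (1 - ε) / 2) =
        ε ^ 2 * (1 / 2 - (1 + ε) / 8 - 1 / 16 * (1 - ε / 2 - ε ^ 2 / 2 + ε ^ 2 * (1 + ε) / 8)
          - ε * (1 - ε / 2) / 64) := by ring
    have h6 : 0 ≤ ε ^ 2 * (1 / 2 - (1 + ε) / 8 - 1 / 16 * (1 - ε / 2 - ε ^ 2 / 2 + ε ^ 2 * (1 + ε) / 8)
          - ε * (1 - ε / 2) / 64) := by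
      have h7 : ε ^ 2 * (1 + ε) ≤ ε ^ 2 * 2 := by gcongr; linarith
      refine mul_nonneg (sq_nonneg ε) ?_
      nlinarith [sq_nonneg ε]
    linarith

/-- There is no good pair that begins in the `n` letters after the first `a`. -/
def NoGoodIn (a n : ℕ) (l : List Letter) : Prop :=
  ∀ i, a ≤ i → i < a + n → ¬ GoodAt l i

/-- Conditioning on the first `a` letters leaves the factor `φ ^ gap`, whose expectation is at most
2 uniformly in `a` by the geometric tail of the gap. -/
theorem prob_noGoodIn_le {ε : ℝ} (h0 : 0 < ε) (h1 : ε < 1) (a n : ℕ) {b : ℕ} (hb : 0 < b) :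
    prob ((1 + ε) / 2) ((1 - ε) / 2) (a + n + b) (NoGoodIn a n) ≤ 2 * (1 - ε ^ 3 / 64) ^ n := by
  have D := decayRates h0 h1
  rw [prob, add_assoc, expect_append]
  refine (expect_mono (g := fun x => (1 - ε ^ 3 / 64) ^ n * (1 + ε ^ 2 / 16) ^ gap x)
    D.p_pos.le D.q_nonneg fun x hx => ?_).trans ?_
  · have h3 := (D.noGood_bound (n + b)).1 x n (by omega)
    subst hx
    rw [mul_comm]
    exact h3
  rw [expect_const_mul, mul_comm]
  have hr : (1 - ε) / 2 / ((1 + ε) / 2) = (1 - ε) / (1 + ε) := by field_simp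
  have hφr : 1 - (1 + ε ^ 2 / 16) * ((1 - ε) / (1 + ε)) =
      ε * (2 - ε / 16 + ε ^ 2 / 16) / (1 + ε) := by
    field_simp; ring
  have hpos : 0 < ε * (2 - ε / 16 + ε ^ 2 / 16) := mul_pos h0 (by nlinarith)
  have h4 := expect_pow_gap_le D.p_pos D.q_nonneg D.add_eq_one D.one_le_φ
    (by rw [hr, ← sub_pos, hφr]; positivity) a
  refine mul_le_mul_of_nonneg_right (h4.trans ?_) (pow_nonneg D.κ_pos.le _)
  rw [hr, hφr]
  have h5 : (1 + ε ^ 2 / 16 - 1) * ((1 - ε) / (1 + ε)) / (ε * (2 - ε / 16 + ε ^ 2 / 16) / (1 + ε))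
      ≤ 1 := by
    rw [div_le_one (by positivity), ← mul_div_assoc]
    refine div_le_div_of_nonneg_right ?_ (by linarith)
    nlinarith [pow_pos h0 2, pow_pos h0 3]
  linarith

/-- A union bound: a window of `m * n` letters splits into `m` windows of `n` letters. -/
theorem one_sub_prob_noGoodIn_mul_le {p q : ℝ} (hp : 0 ≤ p) (hq : 0 ≤ q) (hpq : p + q = 1)
    (a m : ℕ) {n b : ℕ} (hn : 0 < n) (hb : 0 < b) :
    1 - prob p q (a + m * n + b) (NoGoodIn a (m * n)) ≤
      m * (1 - prob p q (a + n + b) (NoGoodIn a n)) := by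
  rw [← prob_not hpq, ← prob_not hpq]
  have h1 : prob p q (a + m * n + b) (fun l => ¬ NoGoodIn a (m * n) l) ≤
      prob p q (a + m * n + b) (fun l => ∃ j ∈ Finset.range m,
        ¬ NoGoodIn a n ((l.drop (j * n)).take (a + n + b))) := by
    refine prob_mono hp hq fun l hl h => ?_
    simp only [NoGoodIn, not_forall, not_not] at h
    obtain ⟨i, hi1, hi2, hi⟩ := h
    obtain ⟨d, rfl⟩ := Nat.exists_eq_add_of_le hi1
    have hd : d / n < m := Nat.div_lt_of_lt_mul (by rw [mul_comm]; omega)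
    refine ⟨d / n, Finset.mem_range.2 hd, fun hno => ?_⟩
    have hdm := Nat.div_add_mod' d n
    have hlt := Nat.mod_lt d hn
    have hmn : d / n * n + n ≤ m * n := by
      rw [← Nat.succ_mul]; exact Nat.mul_le_mul_right n hd
    -- The cut keeps `a` letters before the short window and `b` after it; a pair good in the whole
    -- string stays good in this factor.
    refine hno (a + d % n) (by omega) (by omega) ?_
    refine GoodAt.of_append (u := l.take (d / n * n))
      (v := (l.drop (d / n * n)).drop (a + n + b)) ?_ ?_
    · rw [List.append_assoc, List.take_append_drop, List.take_append_drop,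
        List.length_take_of_le (by omega)]
      convert hi using 1
      omega
    · rw [List.length_take_of_le (by rw [List.length_drop]; omega)]
      omega
  refine h1.trans ((prob_exists_le hp hq hpq _ _ _).trans (le_of_eq ?_))
  rw [Finset.sum_congr rfl fun j hj => ?_, Finset.sum_const, Finset.card_range, nsmul_eq_mul]
  have hj := Finset.mem_range.1 hj
  obtain ⟨c, rfl⟩ := Nat.exists_eq_add_of_lt hj
  rw [show a + (j + c + 1) * n + b = j * n + (a + n + b) + c * n by ring]
  exact prob_middle hpq _ _ _ fun l => ¬ NoGoodIn a n l

theorem prob_noGoodIn_le_exp {ε : ℝ} (h0 : 0 < ε) (h1 : ε < 1) (a n : ℕ) {b : ℕ} (hb : 0 < b) :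
    prob ((1 + ε) / 2) ((1 - ε) / 2) (a + n + b) (NoGoodIn a n) ≤
      Real.exp (-(n * (1 / 512 * ε ^ 3))) := by
  have D := decayRates h0 h1
  set δ := ε ^ 3 / 64 with hδ
  have hδ0 : 0 < δ := by positivity
  have hκ : ∀ m : ℕ, (1 - δ) ^ m ≤ Real.exp (-(m * δ)) := fun m => by
    calc (1 - δ) ^ m ≤ Real.exp (-δ) ^ m :=
          pow_le_pow_left₀ D.κ_pos.le (Real.one_sub_le_exp_neg δ) m
      _ = Real.exp (-(m * δ)) := by rw [← Real.exp_nat_mul]; ring_nf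
  have he : (n : ℝ) * (1 / 512 * ε ^ 3) = n * δ / 8 := by rw [hδ]; ring
  have hexp1 : 2 ≤ Real.exp 1 := by have := Real.add_one_le_exp (1 : ℝ); linarith
  rw [he]
  rcases Nat.eq_zero_or_pos n with rfl | hn
  · simpa using prob_le_one D.p_pos.le D.q_nonneg D.add_eq_one _ _
  have hnδ : 0 < n * δ := by positivity
  -- For `n * δ ≥ 2` the factor `2 ≤ exp 1` is absorbed by the exponent. Otherwise `m` copies of the
  -- window reach `2 ≤ m * n * δ ≤ 4`; the long window has a good pair with probability at least `1
  -- / 2`, so the short one does with probability at least `1 / (2 * m) ≥ n * δ / 8`.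
  rcases le_or_gt 2 (n * δ) with h2 | h2
  · calc _ ≤ 2 * (1 - δ) ^ n := prob_noGoodIn_le h0 h1 a n hb
      _ ≤ Real.exp 1 * Real.exp (-(n * δ)) :=
          mul_le_mul hexp1 (hκ n) (pow_nonneg D.κ_pos.le _) (Real.exp_pos _).le
      _ = Real.exp (1 - n * δ) := by rw [← Real.exp_add]; ring_nf
      _ ≤ Real.exp (-(n * δ / 8)) := Real.exp_le_exp.2 (by linarith)
  · set m := ⌈2 / (n * δ)⌉₊ with hm
    have hm1 : 2 / (n * δ) ≤ m := Nat.le_ceil _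
    have hm2 : (m : ℝ) < 2 / (n * δ) + 1 := Nat.ceil_lt_add_one (by positivity)
    rw [div_le_iff₀ hnδ] at hm1
    have hm3 : m * (n * δ) ≤ 4 := by
      have := mul_lt_mul_of_pos_right hm2 hnδ
      rw [add_mul, div_mul_cancel₀ _ hnδ.ne'] at this
      linarith
    have h3 := one_sub_prob_noGoodIn_mul_le D.p_pos.le D.q_nonneg D.add_eq_one a m hn hb
    have h4 := (prob_noGoodIn_le h0 h1 a (m * n) hb).trans
      (mul_le_mul_of_nonneg_left (hκ (m * n)) (by norm_num))
    have h5 : 2 * Real.exp (-(((m * n : ℕ) : ℝ) * δ)) ≤ 1 / 2 := by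
      have h6 : Real.exp (-(((m * n : ℕ) : ℝ) * δ)) ≤ Real.exp (-2) :=
        Real.exp_le_exp.2 (by push_cast; linarith)
      have h7 : Real.exp (-2) * (Real.exp 1 * Real.exp 1) = 1 := by
        rw [← Real.exp_add, ← Real.exp_add]; norm_num
      have h8 := Real.exp_pos (-2)
      have h9 : 2 * 2 ≤ Real.exp 1 * Real.exp 1 :=
        mul_le_mul hexp1 hexp1 (by norm_num) (by linarith)
      have h10 := mul_le_mul_of_nonneg_left h9 h8.le
      linarith
    set f := prob ((1 + ε) / 2) ((1 - ε) / 2) (a + n + b) (NoGoodIn a n)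
    have h9 : 0 ≤ 1 - f := sub_nonneg.2 (prob_le_one D.p_pos.le D.q_nonneg D.add_eq_one _ _)
    have h10 : n * δ / 8 ≤ 1 - f := by
      have h11 : 1 / 2 ≤ m * (1 - f) := by linarith
      have h12 := mul_le_mul_of_nonneg_right hm3 h9
      have h13 := mul_le_mul_of_nonneg_right h11 hnδ.le
      nlinarith
    have := Real.one_sub_le_exp_neg (n * δ / 8)
    linarith

/-! Bernoulli distributions on characteristic strings -/

instance : Fintype Letter := ⟨{H, A}, fun a => by cases a <;> simp⟩

theorem sum_letter (f : Letter → ℝ) : ∑ a, f a = f H + f A :=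
  Finset.sum_pair (by decide)

theorem expect_eq_sum (p q : ℝ) (n : ℕ) (f : List Letter → ℝ) :
    expect p q n f =
      ∑ w : Fin n → Letter, (∏ i, if w i = A then q else p) * f (List.ofFn w) := by
  induction n generalizing f with
  | zero => simp [expect]
  | succ n ih =>
    rw [← (Fin.consEquiv fun _ : Fin (n + 1) => Letter).sum_comp, Fintype.sum_prod_type, sum_letter,
      expect, ih, ih, Finset.mul_sum, Finset.mul_sum]
    simp [Fin.consEquiv, Fin.prod_univ_succ, List.ofFn_succ, mul_assoc]

theorem IsBernoulli.toReal_toOuterMeasure_le {ε : ℝ} (h0 : 0 < ε) (h1 : ε < 1) {T : ℕ}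
    {ℬ : PMF (CharString T)} (hℬ : IsBernoulli ε ℬ) {E : Set (CharString T)}
    {P : List Letter → Prop} (hE : ∀ w ∈ E, P (List.ofFn w)) :
    (ℬ.toOuterMeasure E).toReal ≤ prob ((1 + ε) / 2) ((1 - ε) / 2) T P := by
  classical
  have hw : ∀ w, (ℬ w).toReal = ∏ i, if w i = A then (1 - ε) / 2 else (1 + ε) / 2 := by
    intro w
    rw [hℬ w, ENNReal.toReal_prod]
    refine Finset.prod_congr rfl fun i _ => ?_
    split_ifs
    · exact ENNReal.toReal_ofReal (by linarith)
    · rw [ENNReal.toReal_ofReal (by linarith)]; ring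
  rw [PMF.toOuterMeasure_apply, tsum_fintype, ENNReal.toReal_sum, prob, expect_eq_sum]
  · refine Finset.sum_le_sum fun w _ => ?_
    rw [← hw w]
    by_cases h : w ∈ E
    · rw [Set.indicator_of_mem h, if_pos (hE w h), mul_one]
    · rw [Set.indicator_of_notMem h, ENNReal.toReal_zero]
      exact mul_nonneg ENNReal.toReal_nonneg (by split_ifs <;> norm_num)
  · intro w _
    exact ((Set.indicator_le_self E _ w).trans_lt (PMF.apply_lt_top ℬ w)).ne

/-! ### The two inequalities of the theorem -/

theorem settlementInsecurity_mono (R : TieBreakingRule) (s k : ℕ) {T : ℕ}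
    {𝒲 ℬ : PMF (CharString T)} (h : StochDominatedBy 𝒲 ℬ) :
    settlementInsecurity R s k 𝒲 ≤ settlementInsecurity R s k ℬ := by
  refine ENNReal.toReal_mono ?_ (h _ (isUpperSet_notSettled R s k T))
  have h1 : ℬ.toOuterMeasure {w | NotSettled R s k w} ≤ ℬ.toOuterMeasure Set.univ :=
    MeasureTheory.measure_mono (Set.subset_univ _)
  rw [(ℬ.toOuterMeasure_apply_eq_one_iff Set.univ).2 (Set.subset_univ _)] at h1
  exact (h1.trans_lt ENNReal.one_lt_top).ne

theorem settlementInsecurity_le_exp (R : TieBreakingRule) {ε : ℝ} (h0 : 0 < ε) (h1 : ε < 1)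
    (s k : ℕ) {T : ℕ} {ℬ : PMF (CharString T)} (hℬ : IsBernoulli ε ℬ) :
    settlementInsecurity R s k ℬ ≤ Real.exp (-(k * (1 / 512 * ε ^ 3))) := by
  by_cases hs : s ≠ 0 ∧ s + k ≤ T
  · obtain ⟨hs0, hsT⟩ := hs
    have h2 := hℬ.toReal_toOuterMeasure_le h0 h1 (E := {w | NotSettled R s k w})
      (P := NoGoodIn (s - 1) k) fun w hw i hi1 hi2 => hw.not_goodAt.2.2 i (by omega) (by omega)
    -- Slot `s` is the letter at index `s - 1`. Since `s ≥ 1` and `s + k ≤ T`, at least one letter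
    -- follows the window.
    have h3 := prob_noGoodIn_le_exp h0 h1 (s - 1) k (b := T - (s - 1 + k)) (by omega)
    rw [show s - 1 + k + (T - (s - 1 + k)) = T by omega] at h3
    exact h2.trans h3
  · have : {w : CharString T | NotSettled R s k w} = ∅ :=
      Set.eq_empty_of_forall_notMem fun w hw =>
        hs ⟨(NotSettled.not_goodAt hw).1, (NotSettled.not_goodAt hw).2.1⟩
    rw [settlementInsecurity, this]
    simpa using (Real.exp_pos _).le

theorem theorem2 :
    ∃ c : ℝ, 0 < c ∧
      ∀ (R : TieBreakingRule) (ε : ℝ), 0 < ε → ε < 1 →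
        ∀ (s k T : ℕ) (ℬ 𝒲 : PMF (CharString T)),
          IsBernoulli ε ℬ → StochDominatedBy 𝒲 ℬ →
            settlementInsecurity R s k 𝒲 ≤ settlementInsecurity R s k ℬ ∧
              settlementInsecurity R s k ℬ ≤ Real.exp (-((k : ℝ) * (c * ε ^ 3))) :=
  ⟨1 / 512, by norm_num, fun R _ h0 h1 s k _ _ _ hℬ hdom =>
    ⟨settlementInsecurity_mono R s k hdom, settlementInsecurity_le_exp R h0 h1 s k hℬ⟩⟩
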